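/- **Theorem 1.3.** For every integer $m\ge 0$ let $(v_n(m))_{n\ge 1}$ be defined by $v_1(m)=0$, $v_2(m)=1$ and $$v_{n+2}(m)=\frac{v_{n+1}(m)}{n+m}+v_n(m)\qquad(n\ge 1).$$ Put $$g(m)=\sqrt{\tfrac{2}{\pi}}\,L_m,\qquad L_m=\delta_{m,0}+\int_0^1 m\,t^{m-1}\sqrt{\frac{1-t}{1+t}}\,\mathrm dt .$$ 1. For every $m\ge 0$, $v_n(m)\sim g(m)\sqrt n$ as $n\to\infty$. 2. There is a meromorphic function $g(z)$ on $\mathbb C$ that takes the value $g(m)$ at every integer $m\ge 0$ and has the following properties. * It has a simple pole at each of $-1,-2,-3,\dots$ and is holomorphic everywhere else, in particular at $z=0$. * For all $z\in\mathbb C\setminus\{-1,-2,\dots\}$, $$g(z+2)=g(z)-\frac{g(z+1)}{z+1}.$$ * For all $z\in\mathbb C\setminus\{-1,-2,\dots\}$, with the convention $1/\Gamma(0)=0$, $$g(z)=\sqrt2\left[\frac{\Gamma(\frac z2+1)}{\Gamma(\frac{z+1}2)}-\frac{\Gamma(\frac{z+1}2)}{\Gamma(\frac z2)}\right].$$ *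 It has polynomial growth in vertical strips: for every strip $a\le\operatorname{Re}z\le b$ containing no pole of $g$ there are $C>0$ and an integer $N\ge 0$ with $|g(z)|\le C(1+|\operatorname{Im}z|)^N$ for all $z$ in the strip. For an arbitrary strip $a\le\operatorname{Re}z\le b$ there are $C>0$ and an integer $N\ge 0$ such that the same bound holds for all $z$ in the strip with $|\operatorname{Im}z|\ge 1$. 3. There are rational numbers $p_m,q_m$ ($m\ge0$) with $$(-1)^m\frac{g(m)}{g(0)}=p_m-\pi q_m\qquad(m\ge 0),$$ given by $p_0=p_1=1$, $q_0=0$, $q_1=\tfrac12$ and, for $k\ge1$, $$p_{2k}=p_{2k+1}=\frac{(2k)!!}{(2k-1)!!},\qquad q_{2k}=\frac12\cdot\frac{(2k-1)!!}{(2k-2)!!},\qquad q_{2k+1}=\frac12\cdot\frac{(2k+1)!!}{(2k)!!},$$ where $0!!=1$. -/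

import Mathlib

open Filter Asymptotics
open scoped Nat

/-- The sequence `v_n(m)`, given for `n ≥ 1` by `v_1(m) = 0`, `v_2(m) = 1` and
`v_{n+2}(m) = v_{n+1}(m) / (n+m) + v_n(m)` for `n ≥ 1`.
The value at `n = 0` is a placeholder that is never used by the recurrence. -/
noncomputable def vSeq (m : ℕ) : ℕ → ℝ
  | 0 => 0
  | 1 => 0
  | 2 => 1
  | (n + 3) => vSeq m (n + 2) / (((n + 1 : ℕ) : ℝ) + (m : ℝ)) + vSeq m (n + 1)

theorem vSeq_one (m : ℕ) : vSeq m 1 = 0 := by simp [vSeq]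

theorem vSeq_two (m : ℕ) : vSeq m 2 = 1 := by simp [vSeq]

theorem vSeq_rec (m n : ℕ) (hn : 1 ≤ n) :
    vSeq m (n + 2) = vSeq m (n + 1) / ((n : ℝ) + (m : ℝ)) + vSeq m n := by
  obtain ⟨k, rfl⟩ := Nat.exists_eq_add_of_le' hn
  show vSeq m (k + 3) = _
  rw [vSeq]

/-- `L_m = δ_{m,0} + ∫_0^1 m t^{m-1} √((1-t)/(1+t)) dt`. (For `m = 0` the integrand is `0`.) -/
noncomputable def LConst (m : ℕ) : ℝ :=
  (if m = 0 then 1 else 0) +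
    ∫ t in (0 : ℝ)..1, (m : ℝ) * t ^ (m - 1) * Real.sqrt ((1 - t) / (1 + t))

/-- The connection constant `g(m) = √(2/π) L_m`. -/
noncomputable def gConst (m : ℕ) : ℝ := Real.sqrt (2 / Real.pi) * LConst m

/-- The set `{-1, -2, -3, …}` in the complex plane. -/
def negIntegers : Set ℂ := {z | ∃ k : ℕ, 1 ≤ k ∧ z = -(k : ℂ)}

/-- Polynomial growth in vertical strips. First, on each closed vertical strip that contains no
pole of `h`, one has `|h(z)| ≤ C (1 + |Im z|)^N`. Second, the same kind of bound holds on an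
arbitrary closed vertical strip away from the real axis, i.e. for `|Im z| ≥ 1`. -/
def PolynomialGrowthInStrips (h : ℂ → ℂ) : Prop :=
  (∀ a b : ℝ, (∀ z : ℂ, a ≤ z.re → z.re ≤ b → ¬ meromorphicOrderAt h z < 0) →
    ∃ C : ℝ, 0 < C ∧ ∃ N : ℕ, ∀ z : ℂ, a ≤ z.re → z.re ≤ b →
      ‖h z‖ ≤ C * (1 + |z.im|) ^ N) ∧
  (∀ a b : ℝ, ∃ C : ℝ, 0 < C ∧ ∃ N : ℕ, ∀ z : ℂ, a ≤ z.re → z.re ≤ b → 1 ≤ |z.im| →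
      ‖h z‖ ≤ C * (1 + |z.im|) ^ N)

/-!
The sequences `v_n(m)`, shifted by `m`, all solve the single recurrence
`u (k + 2) = u (k + 1) / (k + 1) + u k`. Its two basic rational solutions `pCoeff` and `qCoeff` are
quotients of double factorials, and their Casoratian is `(-1)^m / 2`, so that
`v_{j+1}(m) = 2 (-1)^m (p_m q_{m+j} - q_m p_{m+j})` (`vSeq_eq_pCoeff_qCoeff`). Wallis' product gives
`p_n ~ √(π n / 2)`, and `2 p_n q_n = n` then gives `q_n ~ √(2 n / π) / 2`. Hence
`v_n(m) / √n` tends to `√(2/π) (-1)^m (p_m - π q_m)`.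

The integrals `L_m` satisfy `L_{m+2} = L_m - L_{m+1} / (m + 1)`, by integrating the derivative of
`tᵐ (1 - t) √(1 - t²)`; the same recurrence holds for `(-1)^m (p_m - π q_m)`, so the two agree
(`LConst_eq_pCoeff_sub_pi_mul_qCoeff`). This identifies the limit and gives the arithmetic form of
`g(m) / g(0)`; positivity of `L_m` turns the limit into an asymptotic equivalence.

The meromorphic extension `gExt` is defined by its Gamma function formula. The functional equation
of `Γ` yields the recurrence `g(z + 2) = g(z) - g(z + 1) / (z + 1)`, and everything else follows from
it. It reproduces `g(m)` from the values at `0` and `1`. It shows that the residues at the negative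
integers, up to an alternating sign, satisfy a recurrence with positive terms and hence do not
vanish. Finally, it transports growth bounds to the left: for `Re z ≥ a > -1` the bound comes from
`Γ(w + 1/2) / Γ(w) = w B(w + 1/2, 1/2) / √π`, whose Beta integral is bounded on right half-planes.
-/

/-! ### The recurrence over the rationals and its asymptotics -/

/-- The solution of `u (n + 2) = u (n + 1) / (n + 1) + u n` with `u 0 = x` and `u 1 = y`. -/
def ratSol (x y : ℚ) : ℕ → ℚ
  | 0 => x
  | 1 => y
  | n + 2 => ratSol x y (n + 1) / (n + 1) + ratSol x y n

/-- The rational part `p m` of the normalized connection constant. -/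
def pCoeff : ℕ → ℚ := ratSol 1 1

/-- The coefficient `q m` of `-π` in the normalized connection constant. -/
def qCoeff : ℕ → ℚ := ratSol 0 (1 / 2)

theorem pCoeff_add_two (n : ℕ) : pCoeff (n + 2) = pCoeff (n + 1) / (n + 1) + pCoeff n := by
  simp [pCoeff, ratSol]

theorem qCoeff_add_two (n : ℕ) : qCoeff (n + 2) = qCoeff (n + 1) / (n + 1) + qCoeff n := by
  simp [qCoeff, ratSol]

theorem pCoeff_zero : pCoeff 0 = 1 := rfl

theorem pCoeff_one : pCoeff 1 = 1 := rfl

theorem qCoeff_zero : qCoeff 0 = 0 := rfl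

theorem qCoeff_one : qCoeff 1 = 1 / 2 := rfl

theorem pCoeff_odd_even_succ (k : ℕ) :
    pCoeff (2 * k + 1) = pCoeff (2 * k) ∧
      pCoeff (2 * k + 2) = (2 * k + 2) / (2 * k + 1) * pCoeff (2 * k) := by
  have step (k : ℕ) (h : pCoeff (2 * k + 1) = pCoeff (2 * k)) :
      pCoeff (2 * k + 2) = (2 * k + 2) / (2 * k + 1) * pCoeff (2 * k) := by
    rw [pCoeff_add_two, h]
    push_cast
    field_simp
    ring
  have odd (k : ℕ) : pCoeff (2 * k + 1) = pCoeff (2 * k) := by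
    induction k with
    | zero => rfl
    | succ k ih =>
      rw [show 2 * (k + 1) + 1 = 2 * k + 1 + 2 by ring, pCoeff_add_two,
        show 2 * k + 1 + 1 = 2 * k + 2 by ring, show 2 * (k + 1) = 2 * k + 2 by ring,
        step k ih, ih]
      push_cast
      field_simp
      ring
  exact ⟨odd k, step k (odd k)⟩

theorem qCoeff_even_odd_succ (k : ℕ) :
    qCoeff (2 * k + 2) = qCoeff (2 * k + 1) ∧
      qCoeff (2 * k + 3) = (2 * k + 3) / (2 * k + 2) * qCoeff (2 * k + 1) := by
  have step (k : ℕ) (h : qCoeff (2 * k + 2) = qCoeff (2 * k + 1)) :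
      qCoeff (2 * k + 3) = (2 * k + 3) / (2 * k + 2) * qCoeff (2 * k + 1) := by
    rw [show 2 * k + 3 = 2 * k + 1 + 2 by ring, qCoeff_add_two,
      show 2 * k + 1 + 1 = 2 * k + 2 by ring, h]
    push_cast
    field_simp
    ring
  have even (k : ℕ) : qCoeff (2 * k + 2) = qCoeff (2 * k + 1) := by
    induction k with
    | zero => norm_num [qCoeff, ratSol]
    | succ k ih =>
      rw [qCoeff_add_two, show 2 * (k + 1) + 1 = 2 * k + 3 by ring,
        show 2 * (k + 1) = 2 * k + 2 by ring, step k ih, ih]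
      push_cast
      field_simp
      ring
  exact ⟨even k, step k (even k)⟩

theorem pCoeff_even_eq_doubleFactorial (k : ℕ) :
    pCoeff (2 * k) = (((2 * k)‼ : ℕ) : ℚ) / (((2 * k - 1)‼ : ℕ) : ℚ) := by
  induction k with
  | zero => simp [pCoeff_zero]
  | succ k ih =>
    have e : (2 * (k + 1) - 1)‼ = (2 * k + 1) * (2 * k - 1)‼ := by
      cases k with
      | zero => rfl
      | succ j => exact Nat.doubleFactorial_add_two (2 * j + 1)
    rw [show 2 * (k + 1) = 2 * k + 2 by ring, (pCoeff_odd_even_succ k).2, ih,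
      Nat.doubleFactorial_add_two, show 2 * k + 2 - 1 = 2 * (k + 1) - 1 by omega, e]
    push_cast
    rw [div_mul_div_comm]

theorem qCoeff_odd_eq_doubleFactorial (k : ℕ) :
    qCoeff (2 * k + 1) = 1 / 2 * ((((2 * k + 1)‼ : ℕ) : ℚ) / (((2 * k)‼ : ℕ) : ℚ)) := by
  induction k with
  | zero => simp [qCoeff_one]
  | succ k ih =>
    rw [show 2 * (k + 1) + 1 = 2 * k + 3 by ring, (qCoeff_even_odd_succ k).2, ih,
      show (2 * k + 3)‼ = (2 * k + 3) * (2 * k + 1)‼ from Nat.doubleFactorial_add_two (2 * k + 1),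
      show 2 * (k + 1) = 2 * k + 2 by ring, Nat.doubleFactorial_add_two]
    push_cast
    rw [mul_left_comm, div_mul_div_comm]

theorem pCoeff_pos (n : ℕ) : 0 < pCoeff n := by
  induction n using Nat.twoStepInduction with
  | zero => simp [pCoeff_zero]
  | one => simp [pCoeff_one]
  | more n h₀ h₁ => rw [pCoeff_add_two]; positivity

/-- The Casoratian of the two basic solutions. -/
theorem pCoeff_qCoeff_casoratian (m : ℕ) :
    pCoeff m * qCoeff (m + 1) - qCoeff m * pCoeff (m + 1) = (-1) ^ m / 2 := by
  induction m with
  | zero => norm_num [pCoeff, qCoeff, ratSol]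
  | succ m ih =>
    rw [show m + 1 + 1 = m + 2 by ring, pCoeff_add_two, qCoeff_add_two, pow_succ]
    linear_combination -ih

/-- One factor of the product steps at even indices and the other at odd ones, so that the
product gains exactly `1` at each step. -/
theorem two_mul_pCoeff_mul_qCoeff (n : ℕ) : 2 * (pCoeff n * qCoeff n) = n := by
  have odd (k : ℕ) : 2 * (pCoeff (2 * k + 1) * qCoeff (2 * k + 1)) = 2 * k + 1 := by
    induction k with
    | zero => norm_num [pCoeff, qCoeff, ratSol]
    | succ k ih =>
      rw [show 2 * (k + 1) + 1 = 2 * k + 3 by ring, (qCoeff_even_odd_succ k).2,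
        show 2 * k + 3 = 2 * (k + 1) + 1 by ring, (pCoeff_odd_even_succ (k + 1)).1,
        show 2 * (k + 1) = 2 * k + 2 by ring, (pCoeff_odd_even_succ k).2,
        ← (pCoeff_odd_even_succ k).1]
      push_cast
      have : (2 * (k : ℚ) + 1) ≠ 0 := by positivity
      field_simp
      linear_combination (2 * (k : ℚ) + 3) * ih
  obtain ⟨k, rfl | rfl⟩ := n.even_or_odd'
  · cases k with
    | zero => simp [qCoeff_zero]
    | succ k =>
      have h := odd k
      rw [(pCoeff_odd_even_succ k).1] at h
      rw [show 2 * (k + 1) = 2 * k + 2 by ring, (pCoeff_odd_even_succ k).2,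
        (qCoeff_even_odd_succ k).1]
      push_cast
      field_simp
      linear_combination h
  · exact_mod_cast odd k

/-- The square of `pCoeff` is, up to the linear factor, a partial Wallis product. -/
theorem pCoeff_sq (n : ℕ) :
    (pCoeff n : ℝ) ^ 2 = Real.Wallis.W (n / 2) * (2 * ((n / 2 : ℕ) : ℝ) + 1) := by
  have even (k : ℕ) : (pCoeff (2 * k) : ℝ) ^ 2 = Real.Wallis.W k * (2 * (k : ℝ) + 1) := by
    induction k with
    | zero => simp [pCoeff_zero, Real.Wallis.W]
    | succ k ih =>
      rw [show 2 * (k + 1) = 2 * k + 2 by ring, (pCoeff_odd_even_succ k).2, Real.Wallis.W_succ]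
      push_cast
      rw [mul_pow, ih]
      field_simp
      ring
  obtain ⟨k, rfl | rfl⟩ := n.even_or_odd'
  · rw [even, Nat.mul_div_cancel_left _ two_pos]
  · rw [(pCoeff_odd_even_succ k).1, even, show (2 * k + 1) / 2 = k by omega]

theorem tendsto_pCoeff_div_sqrt :
    Tendsto (fun n : ℕ => (pCoeff n : ℝ) / √(n : ℝ)) atTop (nhds √(Real.pi / 2)) := by
  have hhalf : Tendsto (fun n : ℕ => n / 2) atTop atTop := Nat.tendsto_div_const_atTop two_ne_zero
  have hlin : Tendsto (fun n : ℕ => (2 * ((n / 2 : ℕ) : ℝ) + 1) / n) atTop (nhds 1) := by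
    have hup : Tendsto (fun n : ℕ => 1 + 1 / (n : ℝ)) atTop (nhds 1) := by
      simpa using tendsto_one_div_atTop_nhds_zero_nat.const_add (1 : ℝ)
    refine tendsto_of_tendsto_of_tendsto_of_le_of_le' tendsto_const_nhds hup ?_ ?_ <;>
      filter_upwards [eventually_gt_atTop 0] with n hn
    · rw [le_div_iff₀ (by positivity), one_mul]
      exact_mod_cast (by omega : n ≤ 2 * (n / 2) + 1)
    · rw [div_le_iff₀ (by positivity), add_mul, one_div, inv_mul_cancel₀ (by positivity), one_mul]
      exact_mod_cast (by omega : 2 * (n / 2) + 1 ≤ n + 1)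
  have hsq : Tendsto (fun n : ℕ => (pCoeff n : ℝ) ^ 2 / n) atTop (nhds (Real.pi / 2)) := by
    simpa [pCoeff_sq, mul_div_assoc] using
      (Real.Wallis.tendsto_W_nhds_pi_div_two.comp hhalf).mul hlin
  refine ((Real.continuous_sqrt.tendsto _).comp hsq).congr fun n => ?_
  have : (0 : ℝ) ≤ pCoeff n := by exact_mod_cast (pCoeff_pos n).le
  simp [Real.sqrt_div (sq_nonneg _), Real.sqrt_sq this]

theorem tendsto_qCoeff_div_sqrt :
    Tendsto (fun n : ℕ => (qCoeff n : ℝ) / √(n : ℝ)) atTop (nhds (√(2 / Real.pi) / 2)) := by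
  have hne : √(Real.pi / 2) ≠ 0 := by positivity
  have h := (tendsto_pCoeff_div_sqrt.inv₀ hne).div_const 2
  rw [← Real.sqrt_inv, inv_div] at h
  refine h.congr' ?_
  filter_upwards [eventually_gt_atTop 0] with n hn
  have hp : (0 : ℝ) < pCoeff n := by exact_mod_cast pCoeff_pos n
  have hpq : 2 * ((pCoeff n : ℝ) * qCoeff n) = n := by exact_mod_cast two_mul_pCoeff_mul_qCoeff n
  have hs : 0 < √(n : ℝ) := by positivity
  have hss : √(n : ℝ) * √(n : ℝ) = n := Real.mul_self_sqrt (by positivity)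
  field_simp
  linear_combination hss - hpq

/-- Variation of constants: the shifted sequence solves the recurrence of `pCoeff` and `qCoeff`,
and the Casoratian determines its two coordinates. -/
theorem vSeq_eq_pCoeff_qCoeff (m j : ℕ) :
    vSeq m (j + 1) =
      (-1) ^ m * 2 * (pCoeff m * qCoeff (m + j) - qCoeff m * pCoeff (m + j) : ℝ) := by
  induction j using Nat.twoStepInduction with
  | zero => rw [vSeq_one, add_zero]; ring
  | one =>
    have h : (pCoeff m * qCoeff (m + 1) - qCoeff m * pCoeff (m + 1) : ℝ) = (-1) ^ m / 2 := by
      exact_mod_cast congrArg (Rat.cast (K := ℝ)) (pCoeff_qCoeff_casoratian m)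
    have h1 : ((-1 : ℝ) ^ m) * (-1) ^ m = 1 := by rw [← mul_pow]; norm_num
    rw [vSeq_two, h]
    linear_combination -h1
  | more j h₀ h₁ =>
    rw [show j + 2 + 1 = j + 1 + 2 by ring, vSeq_rec m (j + 1) (by omega), h₀, h₁,
      show m + (j + 2) = m + j + 2 by ring, show m + (j + 1) = m + j + 1 by ring,
      pCoeff_add_two, qCoeff_add_two]
    push_cast
    field_simp
    ring

theorem tendsto_vSeq_div_sqrt (m : ℕ) :
    Tendsto (fun n : ℕ => vSeq m n / √(n : ℝ)) atTop
      (nhds (√(2 / Real.pi) * ((-1) ^ m * (pCoeff m - Real.pi * qCoeff m)))) := by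
  have hshift (u : ℕ → ℚ) (c : ℝ)
      (hu : Tendsto (fun n : ℕ => (u n : ℝ) / √(n : ℝ)) atTop (nhds c)) :
      Tendsto (fun j : ℕ => (u (m + j) : ℝ) / √((j + 1 : ℕ) : ℝ)) atTop (nhds c) := by
    have hr : Tendsto (fun j : ℕ => √(((m + j : ℕ) : ℝ) / ((j + 1 : ℕ) : ℝ))) atTop (nhds 1) := by
      have h1 : Tendsto (fun j : ℕ => ((m + j : ℕ) : ℝ) / ((j + 1 : ℕ) : ℝ)) atTop (nhds 1) := by
        have := tendsto_one_div_add_atTop_nhds_zero_nat (𝕜 := ℝ) |>.const_mul ((m : ℝ) - 1)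
          |>.const_add 1
        rw [mul_zero, add_zero] at this
        refine this.congr fun j => ?_
        push_cast
        field_simp
        ring
      simpa [Function.comp_def] using (Real.continuous_sqrt.tendsto _).comp h1
    have hc : Tendsto (fun j : ℕ => m + j) atTop atTop :=
      tendsto_atTop_mono (fun j => Nat.le_add_left j m) tendsto_id
    have := (hu.comp hc).mul hr
    rw [mul_one] at this
    refine this.congr' ?_
    filter_upwards [eventually_gt_atTop 0] with j hj
    have hs : √((m + j : ℕ) : ℝ) ≠ 0 := by positivity
    rw [Function.comp_apply, Real.sqrt_div (by positivity)]
    field_simp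
  rw [← tendsto_add_atTop_iff_nat 1]
  have h := (((hshift _ _ tendsto_qCoeff_div_sqrt).const_mul (pCoeff m : ℝ)).sub
    ((hshift _ _ tendsto_pCoeff_div_sqrt).const_mul (qCoeff m : ℝ))).const_mul ((-1 : ℝ) ^ m * 2)
  have hs : √(Real.pi / 2) = √(2 / Real.pi) * (Real.pi / 2) := by
    rw [Real.sqrt_eq_iff_mul_self_eq (by positivity) (by positivity),
      mul_mul_mul_comm, Real.mul_self_sqrt (by positivity)]
    field_simp
  rw [hs] at h
  convert h using 1
  · ext j
    rw [vSeq_eq_pCoeff_qCoeff]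
    ring
  · congr 1
    ring

/-! ### The integrals `L_m` -/

/-- The moments `∫₀¹ tᵐ √((1-t)/(1+t)) dt`, so that `L_{m+1} = (m+1) * J_m`. -/
noncomputable def sqrtMoment (m : ℕ) : ℝ :=
  ∫ t in (0 : ℝ)..1, t ^ m * √((1 - t) / (1 + t))

theorem continuousOn_sqrt_one_sub_div_one_add :
    ContinuousOn (fun t : ℝ => √((1 - t) / (1 + t))) (Set.Icc 0 1) := by
  refine ContinuousOn.sqrt (ContinuousOn.div (by fun_prop) (by fun_prop) fun t ht => ?_)
  have := ht.1
  positivity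

theorem intervalIntegrable_mul_sqrt {f : ℝ → ℝ} (hf : Continuous f) :
    IntervalIntegrable (fun t => f t * √((1 - t) / (1 + t))) MeasureTheory.volume 0 1 := by
  refine ContinuousOn.intervalIntegrable ?_
  rw [Set.uIcc_of_le zero_le_one]
  exact hf.continuousOn.mul continuousOn_sqrt_one_sub_div_one_add

theorem sqrt_one_sub_div_one_add {t : ℝ} (h₀ : 0 ≤ t) :
    √((1 - t) / (1 + t)) = √(1 - t ^ 2) / (1 + t) := by
  rw [show (1 - t) / (1 + t) = (1 - t ^ 2) / (1 + t) ^ 2 by field_simp; ring,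
    Real.sqrt_div' _ (sq_nonneg _), Real.sqrt_sq (by linarith)]

theorem hasDerivAt_sqrt_one_sub_sq {t : ℝ} (ht : t ∈ Set.Ioo (0 : ℝ) 1) :
    HasDerivAt (fun t : ℝ => √(1 - t ^ 2)) (-t / √(1 - t ^ 2)) t := by
  have hpos : 0 < 1 - t ^ 2 := by nlinarith [ht.1, ht.2]
  have h := ((hasDerivAt_pow 2 t).const_sub 1).sqrt hpos.ne'
  convert h using 1
  have : √(1 - t ^ 2) ≠ 0 := by positivity
  field_simp
  push_cast
  ring

theorem sqrtMoment_zero : sqrtMoment 0 = Real.pi / 2 - 1 := by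
  have h : ∫ t in (0 : ℝ)..1, t ^ 0 * √((1 - t) / (1 + t)) =
      (Real.arcsin 1 + √(1 - 1 ^ 2)) - (Real.arcsin 0 + √(1 - 0 ^ 2)) := by
    refine intervalIntegral.integral_eq_sub_of_hasDerivAt_of_le
      (f := fun t => Real.arcsin t + √(1 - t ^ 2)) zero_le_one
      (Real.continuous_arcsin.add (by fun_prop)).continuousOn (fun t ht => ?_)
      (intervalIntegrable_mul_sqrt (by fun_prop))
    have hpos : 0 < 1 - t ^ 2 := by nlinarith [ht.1, ht.2]
    refine ((Real.hasDerivAt_arcsin (by linarith [ht.1]) ht.2.ne).add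
      (hasDerivAt_sqrt_one_sub_sq ht)).congr_deriv ?_
    rw [sqrt_one_sub_div_one_add ht.1.le]
    have hs : √(1 - t ^ 2) ≠ 0 := by positivity
    have hss := Real.sq_sqrt hpos.le
    have ht1 : 1 + t ≠ 0 := by linarith [ht.1]
    field_simp
    rw [hss]
    ring
  rw [sqrtMoment, h]
  norm_num

/-- The integrand is the derivative of `tᵐ (1 - t) √(1 - t²)`, which vanishes at `1`, and at `0`
unless `m = 0`. -/
theorem sqrtMoment_add_one (m : ℕ) :
    (m + 2) * sqrtMoment (m + 1) =
      (if m = 0 then 1 else 0) + m * sqrtMoment (m - 1) - sqrtMoment m := by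
  have h : ∫ t in (0 : ℝ)..1, (m * t ^ (m - 1) - t ^ m - (m + 2) * t ^ (m + 1)) *
      √((1 - t) / (1 + t)) =
      1 ^ m * (1 - 1) * √(1 - 1 ^ 2) - 0 ^ m * (1 - 0) * √(1 - 0 ^ 2) := by
    refine intervalIntegral.integral_eq_sub_of_hasDerivAt_of_le
      (f := fun t => t ^ m * (1 - t) * √(1 - t ^ 2)) zero_le_one
      (by fun_prop) (fun t ht => ?_)
      (intervalIntegrable_mul_sqrt (by fun_prop))
    have hpos : 0 < 1 - t ^ 2 := by nlinarith [ht.1, ht.2]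
    refine (((hasDerivAt_pow m t).mul ((hasDerivAt_id t).const_sub 1)).mul
      (hasDerivAt_sqrt_one_sub_sq ht)).congr_deriv ?_
    rw [sqrt_one_sub_div_one_add ht.1.le]
    have hs : √(1 - t ^ 2) ≠ 0 := by positivity
    have hss := Real.sq_sqrt hpos.le
    have ht1 : 1 + t ≠ 0 := by linarith [ht.1]
    simp only [Pi.mul_apply, id_eq]
    field_simp
    rw [hss]
    cases m with
    | zero => simp; ring
    | succ k =>
      push_cast
      ring
  have hsplit : ∫ t in (0 : ℝ)..1, (m * t ^ (m - 1) - t ^ m - (m + 2) * t ^ (m + 1)) *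
      √((1 - t) / (1 + t)) =
      m * sqrtMoment (m - 1) - sqrtMoment m - (m + 2) * sqrtMoment (m + 1) := by
    simp only [sqrtMoment, ← intervalIntegral.integral_const_mul]
    have hi (k : ℕ) := intervalIntegrable_mul_sqrt (f := fun t : ℝ => t ^ k) (by fun_prop)
    rw [← intervalIntegral.integral_sub ((hi _).const_mul _) (hi _),
      ← intervalIntegral.integral_sub (((hi _).const_mul _).sub (hi _)) ((hi _).const_mul _)]
    congr 1
    ext t
    ring
  rw [hsplit] at h
  by_cases hm : m = 0
  · subst hm
    simp at h ⊢
    linarith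
  · simp [hm] at h ⊢
    linarith

theorem LConst_zero : LConst 0 = 1 := by simp [LConst]

theorem LConst_add_one (m : ℕ) : LConst (m + 1) = (m + 1) * sqrtMoment m := by
  simp only [LConst, sqrtMoment, ← intervalIntegral.integral_const_mul]
  simp [mul_assoc]

theorem LConst_one : LConst 1 = Real.pi / 2 - 1 := by
  simpa [sqrtMoment_zero] using LConst_add_one 0

theorem LConst_add_two (m : ℕ) : LConst (m + 2) = LConst m - LConst (m + 1) / (m + 1) := by
  have hm : LConst m = (if m = 0 then 1 else 0) + m * sqrtMoment (m - 1) := by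
    cases m with
    | zero => simp [LConst_zero]
    | succ k => simp [LConst_add_one]
  have h := sqrtMoment_add_one m
  rw [hm, show m + 2 = m + 1 + 1 by ring, LConst_add_one, LConst_add_one]
  push_cast
  field_simp
  linarith

theorem LConst_pos (m : ℕ) : 0 < LConst m := by
  cases m with
  | zero => simp [LConst_zero]
  | succ k =>
    rw [LConst_add_one]
    refine mul_pos (by positivity) (intervalIntegral.intervalIntegral_pos_of_pos_on
      (intervalIntegrable_mul_sqrt (by fun_prop)) (fun t ht => ?_) zero_lt_one)
    have h₀ := ht.1
    have h₁ : 0 < 1 - t := by linarith [ht.2]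
    positivity

theorem LConst_eq_pCoeff_sub_pi_mul_qCoeff (m : ℕ) :
    LConst m = (-1) ^ m * (pCoeff m - Real.pi * qCoeff m) := by
  induction m using Nat.twoStepInduction with
  | zero => simp [LConst_zero, pCoeff_zero, qCoeff_zero]
  | one => rw [LConst_one, pCoeff_one, qCoeff_one]; push_cast; ring
  | more m h₀ h₁ =>
    rw [LConst_add_two, h₀, h₁, pCoeff_add_two, qCoeff_add_two]
    push_cast
    ring

theorem gConst_zero : gConst 0 = √(2 / Real.pi) := by rw [gConst, LConst_zero, mul_one]

theorem gConst_add_two (m : ℕ) : gConst (m + 2) = gConst m - gConst (m + 1) / (m + 1) := by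
  simp only [gConst, LConst_add_two]
  ring

theorem gConst_pos (m : ℕ) : 0 < gConst m := mul_pos (by positivity) (LConst_pos m)

theorem vSeq_isEquivalent (m : ℕ) :
    (fun n : ℕ => vSeq m n) ~[atTop] (fun n : ℕ => gConst m * √(n : ℝ)) := by
  have h := tendsto_vSeq_div_sqrt m
  rw [← LConst_eq_pCoeff_sub_pi_mul_qCoeff] at h
  have hg := (gConst_pos m).ne'
  refine isEquivalent_of_tendsto_one ?_
  have h' := h.div_const (gConst m)
  rw [← gConst, div_self hg] at h'
  refine h'.congr fun n => ?_
  simp only [Pi.div_apply]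
  rw [div_div, mul_comm]

/-! ### The meromorphic extension: recurrence, values and poles -/

/-- The Gamma quotient `Γ(w + 1/2) / Γ(w)`. -/
noncomputable def gammaQuot (w : ℂ) : ℂ := Complex.Gamma (w + 1 / 2) * (Complex.Gamma w)⁻¹

/-- The meromorphic extension of the connection constants. At its poles it takes a junk value. -/
noncomputable def gExt (z : ℂ) : ℂ :=
  ((√2 : ℝ) : ℂ) *
    (Complex.Gamma (z / 2 + 1) * (Complex.Gamma ((z + 1) / 2))⁻¹
      - Complex.Gamma ((z + 1) / 2) * (Complex.Gamma (z / 2))⁻¹)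

theorem gExt_eq_gammaQuot (z : ℂ) :
    gExt z = ((√2 : ℝ) : ℂ) * (gammaQuot ((z + 1) / 2) - gammaQuot (z / 2)) := by
  rw [gExt, gammaQuot, gammaQuot, show (z + 1) / 2 + 1 / 2 = z / 2 + 1 by ring,
    show z / 2 + 1 / 2 = (z + 1) / 2 by ring]

theorem ne_neg_of_notMem_negIntegers {z : ℂ} (hz : z ∉ negIntegers) (k : ℕ) : z ≠ -(k + 1) :=
  fun h => hz ⟨k + 1, by omega, by rw [h]; push_cast; ring⟩

theorem half_add_one_ne_neg {z : ℂ} (hz : z ∉ negIntegers) (m : ℕ) : z / 2 + 1 ≠ -m := by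
  intro h
  refine ne_neg_of_notMem_negIntegers hz (2 * m + 1) ?_
  push_cast
  linear_combination 2 * h

theorem add_one_half_ne_neg {z : ℂ} (hz : z ∉ negIntegers) (m : ℕ) : (z + 1) / 2 ≠ -m := by
  intro h
  refine ne_neg_of_notMem_negIntegers hz (2 * m) ?_
  push_cast
  linear_combination 2 * h

theorem gExt_add_two {z : ℂ} (hz : z ∉ negIntegers) :
    gExt (z + 2) = gExt z - gExt (z + 1) / (z + 1) := by
  have ha := Complex.Gamma_ne_zero (half_add_one_ne_neg hz)
  have hb := Complex.Gamma_ne_zero (add_one_half_ne_neg hz)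
  have ha0 : z / 2 + 1 ≠ 0 := by simpa using half_add_one_ne_neg hz 0
  have hb0 : (z + 1) / 2 ≠ 0 := by simpa using add_one_half_ne_neg hz 0
  have hz1 : z + 1 ≠ 0 := fun h => hb0 (by rw [h, zero_div])
  have e1 := Complex.Gamma_add_one _ ha0
  have e2 := Complex.Gamma_add_one _ hb0
  have e3 := Complex.one_div_Gamma_eq_self_mul_one_div_Gamma_add_one (z / 2)
  unfold gExt
  rw [e3, show (z + 2) / 2 + 1 = z / 2 + 1 + 1 by ring,
    show (z + 2 + 1) / 2 = (z + 1) / 2 + 1 by ring,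
    show (z + 2) / 2 = z / 2 + 1 by ring, show (z + 1) / 2 + 1 = (z + 1) / 2 + 1 by ring,
    show (z + 1 + 1) / 2 = z / 2 + 1 by ring, e1, e2]
  field_simp
  ring

theorem gExt_zero : gExt 0 = (gConst 0 : ℝ) := by
  rw [gConst_zero, gExt]
  simp only [zero_div, Complex.Gamma_zero, inv_zero, mul_zero, sub_zero, zero_add,
    Complex.Gamma_one, one_mul]
  rw [Complex.Gamma_one_half_eq, Real.sqrt_div zero_le_two]
  rw [Real.sqrt_eq_rpow Real.pi, Complex.ofReal_div, Complex.ofReal_cpow Real.pi_pos.le]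
  push_cast
  rfl

theorem gExt_one : gExt 1 = (gConst 1 : ℝ) := by
  have hpi : Complex.Gamma (1 / 2) = ((√Real.pi : ℝ) : ℂ) := by
    rw [Complex.Gamma_one_half_eq, Real.sqrt_eq_rpow Real.pi, Complex.ofReal_cpow Real.pi_pos.le]
    push_cast
    rfl
  rw [gConst, LConst_one, gExt, Complex.Gamma_add_one _ (by norm_num), hpi,
    show ((1 : ℂ) + 1) / 2 = 1 by norm_num, Complex.Gamma_one, Real.sqrt_div zero_le_two]
  have h : ((√Real.pi : ℝ) : ℂ) ≠ 0 := by
    rw [Complex.ofReal_ne_zero]; positivity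
  have hs : ((√Real.pi : ℝ) : ℂ) ^ 2 = (Real.pi : ℂ) := by
    exact_mod_cast congrArg Complex.ofReal (Real.sq_sqrt Real.pi_pos.le)
  push_cast
  rw [← hs]
  field_simp

theorem natCast_notMem_negIntegers (m : ℕ) : (m : ℂ) ∉ negIntegers := by
  rintro ⟨k, hk, h⟩
  have : (m + k : ℕ) = 0 := by
    have : ((m + k : ℕ) : ℂ) = 0 := by push_cast; rw [h]; ring
    exact_mod_cast this
  omega

theorem gExt_natCast (m : ℕ) : gExt m = (gConst m : ℝ) := by
  induction m using Nat.twoStepInduction with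
  | zero => simpa using gExt_zero
  | one => simpa using gExt_one
  | more m h₀ h₁ =>
    have h := gExt_add_two (natCast_notMem_negIntegers m)
    push_cast at h₁ ⊢
    rw [h, h₀, h₁, gConst_add_two]
    push_cast
    rfl

theorem analyticAt_Gamma {s : ℂ} (hs : ∀ m : ℕ, s ≠ -m) : AnalyticAt ℂ Complex.Gamma s := by
  have h := (Complex.differentiable_one_div_Gamma.analyticAt s).inv
    (inv_ne_zero (Complex.Gamma_ne_zero hs))
  exact h.congr (Eventually.of_forall fun z => inv_inv _)

theorem analyticAt_gExt {z : ℂ} (hz : z ∉ negIntegers) : AnalyticAt ℂ gExt z := by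
  have h1 : AnalyticAt ℂ (fun z : ℂ => Complex.Gamma (z / 2 + 1)) z :=
    (analyticAt_Gamma (half_add_one_ne_neg hz)).fun_comp (f := fun z : ℂ => z / 2 + 1) (by fun_prop)
  have h2 : AnalyticAt ℂ (fun z : ℂ => Complex.Gamma ((z + 1) / 2)) z :=
    (analyticAt_Gamma (add_one_half_ne_neg hz)).fun_comp (f := fun z : ℂ => (z + 1) / 2)
      (by fun_prop)
  have h3 : AnalyticAt ℂ (fun z : ℂ => (Complex.Gamma (z / 2))⁻¹) z :=
    (Complex.differentiable_one_div_Gamma.analyticAt _).fun_comp (f := fun z : ℂ => z / 2)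
      (by fun_prop)
  exact analyticAt_const.mul
    ((h1.mul (h2.inv (Complex.Gamma_ne_zero (add_one_half_ne_neg hz)))).sub (h2.mul h3))

theorem meromorphicAt_gExt (z : ℂ) : MeromorphicAt gExt z := by
  have h1 : MeromorphicAt (fun z : ℂ => Complex.Gamma (z / 2 + 1)) z :=
    (Meromorphic.Gamma (z / 2 + 1)).comp_analyticAt (g := fun z : ℂ => z / 2 + 1) (by fun_prop)
  have h2 : MeromorphicAt (fun z : ℂ => Complex.Gamma ((z + 1) / 2)) z :=
    (Meromorphic.Gamma ((z + 1) / 2)).comp_analyticAt (g := fun z : ℂ => (z + 1) / 2)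
      (by fun_prop)
  have h3 : MeromorphicAt (fun z : ℂ => Complex.Gamma (z / 2)) z :=
    (Meromorphic.Gamma (z / 2)).comp_analyticAt (g := fun z : ℂ => z / 2) (by fun_prop)
  exact (MeromorphicAt.const _ _).mul ((h1.mul h2.inv).sub (h2.mul h3.inv))

theorem eventually_notMem_negIntegers (k : ℕ) :
    ∀ᶠ z in nhdsWithin (-(k + 1)) {(-(k + 1) : ℂ)}ᶜ, z ∉ negIntegers := by
  filter_upwards [self_mem_nhdsWithin,
    mem_nhdsWithin_of_mem_nhds (Metric.ball_mem_nhds _ one_pos)] with z hz hball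
  rintro ⟨j, -, rfl⟩
  have h : |((k + 1 - j : ℤ) : ℝ)| < 1 := by
    rw [mem_ball_iff_norm, show (-(j : ℂ) - -(k + 1)) = ((k + 1 - j : ℤ) : ℂ) by push_cast; ring,
      Complex.norm_intCast] at hball
    exact hball
  have h0 : (k + 1 - j : ℤ) = 0 := Int.abs_lt_one_iff.1 (by exact_mod_cast h)
  refine hz ?_
  rw [show j = k + 1 by omega]
  simp

/-- The residues of `gExt` alternate in sign: up to sign they solve, by the recurrence for `gExt`,
the recurrence `r (k + 2) = r (k + 1) / (k + 2) + r k`, so they do not vanish. -/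
theorem exists_tendsto_residue_gExt (k : ℕ) : ∃ r : ℝ, 0 < r ∧
    Tendsto (fun z : ℂ => (z + (k + 1)) * gExt z) (nhdsWithin (-(k + 1)) {(-(k + 1) : ℂ)}ᶜ)
      (nhds ((-1) ^ k * r)) := by
  have key (k : ℕ) (a b : ℂ)
      (ha : Tendsto (fun z : ℂ => (z + (k + 1)) * gExt (z + 2))
        (nhdsWithin (-(k + 1)) {(-(k + 1) : ℂ)}ᶜ) (nhds a))
      (hb : Tendsto (fun z : ℂ => (z + (k + 1)) * (gExt (z + 1) / (z + 1)))
        (nhdsWithin (-(k + 1)) {(-(k + 1) : ℂ)}ᶜ) (nhds b)) :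
      Tendsto (fun z : ℂ => (z + (k + 1)) * gExt z)
        (nhdsWithin (-(k + 1)) {(-(k + 1) : ℂ)}ᶜ) (nhds (a + b)) := by
    refine (ha.add hb).congr' ?_
    filter_upwards [eventually_notMem_negIntegers _] with z hz
    rw [gExt_add_two hz]
    ring
  have shift (j : ℂ) (x : ℂ) : Tendsto (fun z : ℂ => z + j) (nhdsWithin x {x}ᶜ)
      (nhdsWithin (x + j) {x + j}ᶜ) := by
    refine tendsto_nhdsWithin_iff.2 ⟨?_, ?_⟩
    · exact ((continuous_add_const j).tendsto x).mono_left nhdsWithin_le_nhds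
    · filter_upwards [self_mem_nhdsWithin] with z hz
      simpa using hz
  -- At a point where `gExt` is analytic the factor vanishing there forces the limit `0`.
  have vanish (k : ℕ) (c : ℕ) (x : ℂ) (hx : x = -(k + 1)) (hc : x + 2 = c) :
      Tendsto (fun z : ℂ => (z + (k + 1)) * gExt (z + 2)) (nhdsWithin x {x}ᶜ) (nhds 0) := by
    have hcont : ContinuousAt (fun z : ℂ => (z + (k + 1)) * gExt (z + 2)) x := by
      refine ContinuousAt.mul (by fun_prop)
        (ContinuousAt.comp' (f := fun z : ℂ => z + 2) ?_ (by fun_prop))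
      rw [hc]
      exact (analyticAt_gExt (natCast_notMem_negIntegers c)).continuousAt
    have := hcont.tendsto.mono_left (nhdsWithin_le_nhds (s := {x}ᶜ))
    simpa [hx] using this
  have hb (k : ℕ) (r : ℝ) (h : Tendsto (fun z : ℂ => (z + (k + 1)) * gExt z)
      (nhdsWithin (-(k + 1)) {(-(k + 1) : ℂ)}ᶜ) (nhds ((-1) ^ k * r))) :
      Tendsto (fun z : ℂ => (z + ((k + 1 : ℕ) + 1)) * (gExt (z + 1) / (z + 1)))
        (nhdsWithin (-((k + 1 : ℕ) + 1)) {(-((k + 1 : ℕ) + 1) : ℂ)}ᶜ)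
        (nhds ((-1) ^ (k + 1) * (r / (k + 1) : ℝ))) := by
    have hs := shift 1 (-((k + 1 : ℕ) + 1))
    rw [show -(((k + 1 : ℕ) : ℂ) + 1) + 1 = -(k + 1) by push_cast; ring] at hs
    have hk : (-(k + 1) : ℂ) ≠ 0 := neg_ne_zero.2 (by exact_mod_cast k.succ_ne_zero)
    have := (h.comp hs).div (hs.mono_right nhdsWithin_le_nhds) hk
    convert this using 1
    · ext z
      simp only [Function.comp_apply, Pi.div_apply]
      push_cast
      ring
    · congr 1
      push_cast
      field_simp
      ring
  have base : Tendsto (fun z : ℂ => (z + ((0 : ℕ) + 1)) * gExt z)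
      (nhdsWithin (-((0 : ℕ) + 1)) {(-((0 : ℕ) + 1) : ℂ)}ᶜ)
      (nhds ((-1) ^ 0 * (gConst 0 : ℝ))) := by
    have h1 := vanish 0 1 (-((0 : ℕ) + 1)) rfl (by norm_num)
    have h2 : Tendsto (fun z : ℂ => (z + ((0 : ℕ) + 1)) * (gExt (z + 1) / (z + 1)))
        (nhdsWithin (-((0 : ℕ) + 1)) {(-((0 : ℕ) + 1) : ℂ)}ᶜ) (nhds (gConst 0 : ℝ)) := by
      have hs := shift 1 (-((0 : ℕ) + 1))
      have hc := (analyticAt_gExt (natCast_notMem_negIntegers 0)).continuousAt.tendsto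
      rw [gExt_natCast] at hc
      rw [show -(((0 : ℕ) : ℂ) + 1) + 1 = (0 : ℕ) by push_cast; ring] at hs
      refine (hc.comp (hs.mono_right nhdsWithin_le_nhds)).congr' ?_
      filter_upwards [self_mem_nhdsWithin] with z hz
      have : z + 1 ≠ 0 := fun h => hz (by
        rw [Set.mem_singleton_iff]
        push_cast
        linear_combination h)
      simp only [Function.comp_apply]
      push_cast
      field_simp
      ring
    simpa using key 0 _ _ h1 h2
  induction k using Nat.twoStepInduction with
  | zero => exact ⟨gConst 0, gConst_pos 0, base⟩
  | one =>
    refine ⟨gConst 0 / ((0 : ℕ) + 1), div_pos (gConst_pos 0) (by norm_num), ?_⟩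
    have h1 := vanish 1 0 (-((1 : ℕ) + 1)) rfl (by norm_num)
    simpa using key 1 _ _ h1 (hb 0 _ base)
  | more k h₀ h₁ =>
    obtain ⟨r₀, hr₀, h₀⟩ := h₀
    obtain ⟨r₁, hr₁, h₁⟩ := h₁
    refine ⟨r₀ + r₁ / ((k + 1 : ℕ) + 1), by positivity, ?_⟩
    have h2 := hb (k + 1) r₁ h₁
    have h1 : Tendsto (fun z : ℂ => (z + ((k + 1 + 1 : ℕ) + 1)) * gExt (z + 2))
        (nhdsWithin (-((k + 1 + 1 : ℕ) + 1)) {(-((k + 1 + 1 : ℕ) + 1) : ℂ)}ᶜ)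
        (nhds ((-1) ^ k * r₀)) := by
      have hs := shift 2 (-((k + 1 + 1 : ℕ) + 1))
      rw [show -(((k + 1 + 1 : ℕ) : ℂ) + 1) + 2 = -(k + 1) by push_cast; ring] at hs
      refine (h₀.comp hs).congr fun z => ?_
      simp only [Function.comp_apply]
      push_cast
      ring
    convert key _ _ _ h1 h2 using 2
    push_cast
    ring

theorem meromorphicOrderAt_gExt {z : ℂ} (hz : z ∈ negIntegers) : meromorphicOrderAt gExt z = -1 := by
  obtain ⟨k, hk, rfl⟩ := hz
  obtain ⟨k, rfl⟩ := Nat.exists_eq_add_of_le' hk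
  obtain ⟨r, hr, h⟩ := exists_tendsto_residue_gExt k
  have hid : MeromorphicAt (fun z : ℂ => z - -((k + 1 : ℕ) : ℂ)) (-((k + 1 : ℕ) : ℂ)) := by fun_prop
  have hg := meromorphicAt_gExt (-((k + 1 : ℕ) : ℂ))
  have h0 : meromorphicOrderAt ((fun z : ℂ => z - -((k + 1 : ℕ) : ℂ)) * gExt)
      (-((k + 1 : ℕ) : ℂ)) = 0 := by
    rw [← tendsto_ne_zero_iff_meromorphicOrderAt_eq_zero (hid.mul hg)]
    refine ⟨(-1) ^ k * r, by simp [hr.ne'], ?_⟩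
    push_cast
    convert h using 1
    ext z
    rw [Pi.mul_apply]
    ring
  rw [meromorphicOrderAt_mul hid hg, meromorphicOrderAt_id_sub_const] at h0
  cases ho : meromorphicOrderAt gExt (-((k + 1 : ℕ) : ℂ)) with
  | top =>
    rw [ho] at h0
    exact absurd h0 (by decide)
  | coe n =>
    rw [ho] at h0
    have : (1 + n : ℤ) = 0 := by exact_mod_cast h0
    rw [show n = -1 by omega]
    rfl

/-! ### Growth in vertical strips -/

theorem norm_betaIntegral_le {a : ℝ} {u v : ℂ} (ha : 0 < a) (hu : a ≤ u.re) (hv : 0 < v.re) :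
    ‖Complex.betaIntegral u v‖ ≤
      ∫ x in (0 : ℝ)..1, ‖(x : ℂ) ^ ((a : ℂ) - 1) * (1 - (x : ℂ)) ^ (v - 1)‖ := by
  refine intervalIntegral.norm_integral_le_of_norm_le zero_le_one
    (Eventually.of_forall fun x hx => ?_)
    (Complex.betaIntegral_convergent (by simpa using ha) hv).norm
  rw [norm_mul, norm_mul, Complex.norm_cpow_eq_rpow_re_of_pos hx.1,
    Complex.norm_cpow_eq_rpow_re_of_pos hx.1]
  refine mul_le_mul_of_nonneg_right ?_ (norm_nonneg _)
  exact Real.rpow_le_rpow_of_exponent_ge hx.1 hx.2 (by simpa using hu)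

/-- The quotient equals `w * B(w + 1/2, 1/2) / √π`, and the Beta integral is bounded on right
half-planes. -/
theorem exists_norm_gammaQuot_le {a : ℝ} (ha : -(1 / 2) < a) :
    ∃ C : ℝ, 0 < C ∧ ∀ w : ℂ, a ≤ w.re → ‖gammaQuot w‖ ≤ C * ‖w‖ := by
  set M := ∫ x in (0 : ℝ)..1,
    ‖(x : ℂ) ^ (((a + 1 / 2 : ℝ) : ℂ) - 1) * (1 - (x : ℂ)) ^ ((1 / 2 : ℂ) - 1)‖
  have hM : 0 ≤ M := intervalIntegral.integral_nonneg zero_le_one fun _ _ => norm_nonneg _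
  have hhalf : (0 : ℝ) < (1 / 2 : ℂ).re := by norm_num
  have hG : 0 < ‖Complex.Gamma (1 / 2)‖ :=
    norm_pos_iff.2 (Complex.Gamma_ne_zero_of_re_pos hhalf)
  refine ⟨(M + 1) / ‖Complex.Gamma (1 / 2)‖, by positivity, fun w hw => ?_⟩
  have hre : (w + 1 / 2).re = w.re + 1 / 2 := by norm_num
  have hB : ‖Complex.betaIntegral (w + 1 / 2) (1 / 2)‖ ≤ M :=
    norm_betaIntegral_le (a := a + 1 / 2) (u := w + 1 / 2) (v := 1 / 2) (by linarith)
      (by rw [hre]; linarith) hhalf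
  have hmul := Complex.Gamma_mul_Gamma_eq_betaIntegral (s := w + 1 / 2) (t := 1 / 2)
    (by rw [hre]; linarith) hhalf
  rw [show w + 1 / 2 + 1 / 2 = w + 1 by ring] at hmul
  have hne : Complex.Gamma (w + 1) ≠ 0 := Complex.Gamma_ne_zero_of_re_pos (by
    rw [Complex.add_re, Complex.one_re]; linarith)
  have hq : gammaQuot w =
      w * (Complex.betaIntegral (w + 1 / 2) (1 / 2) / Complex.Gamma (1 / 2)) := by
    rw [gammaQuot, Complex.one_div_Gamma_eq_self_mul_one_div_Gamma_add_one]
    have := norm_pos_iff.1 hG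
    rw [mul_left_comm]
    congr 1
    rw [mul_inv_eq_iff_eq_mul₀ hne, div_mul_eq_mul_div, eq_div_iff this, hmul, mul_comm]
  rw [hq, norm_mul, norm_div, mul_comm]
  gcongr
  linarith

theorem exists_norm_gExt_le_of_neg_one_lt {a : ℝ} (ha : -1 < a) (b : ℝ) :
    ∃ C : ℝ, 0 < C ∧ ∀ z : ℂ, a ≤ z.re → z.re ≤ b → ‖gExt z‖ ≤ C * (1 + |z.im|) := by
  obtain ⟨C, hC, hbound⟩ := exists_norm_gammaQuot_le (a := a / 2) (by linarith)
  set R := |a| + |b| + 1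
  have hR : 0 < R := by positivity
  refine ⟨√2 * (C * (R + 1)), by positivity, fun z h₁ h₂ => ?_⟩
  have hz : ‖z‖ ≤ R + |z.im| := by
    have hre : |z.re| ≤ |a| + |b| :=
      abs_le.2 ⟨by linarith [neg_abs_le a, abs_nonneg b], by linarith [le_abs_self b, abs_nonneg a]⟩
    have := Complex.norm_le_abs_re_add_abs_im z
    linarith
  have hg1 := hbound ((z + 1) / 2) (by
    rw [show (z + 1) / 2 = ((1 / 2 : ℝ) : ℂ) * (z + 1) by push_cast; ring, Complex.re_ofReal_mul,
      Complex.add_re, Complex.one_re]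
    linarith)
  have hg2 := hbound (z / 2) (by
    rw [show z / 2 = ((1 / 2 : ℝ) : ℂ) * z by push_cast; ring, Complex.re_ofReal_mul]
    linarith)
  have hn1 : ‖(z + 1) / 2‖ ≤ (‖z‖ + 1) / 2 := by
    rw [norm_div, Complex.norm_two]
    have := norm_add_le z 1
    rw [norm_one] at this
    gcongr
  have hn2 : ‖z / 2‖ = ‖z‖ / 2 := by rw [norm_div, Complex.norm_two]
  rw [gExt_eq_gammaQuot, norm_mul, Complex.norm_real, Real.norm_of_nonneg (Real.sqrt_nonneg _),
    mul_assoc]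
  refine mul_le_mul_of_nonneg_left ?_ (Real.sqrt_nonneg _)
  calc ‖gammaQuot ((z + 1) / 2) - gammaQuot (z / 2)‖
      ≤ C * ‖(z + 1) / 2‖ + C * ‖z / 2‖ := (norm_sub_le _ _).trans (add_le_add hg1 hg2)
    _ ≤ C * ((‖z‖ + 1) / 2) + C * (‖z‖ / 2) := by rw [hn2]; gcongr
    _ = C * (‖z‖ + 1 / 2) := by ring
    _ ≤ C * ((R + 1) * (1 + |z.im|)) := by
      gcongr
      nlinarith [mul_nonneg hR.le (abs_nonneg z.im)]
    _ = C * (R + 1) * (1 + |z.im|) := by ring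

theorem notMem_negIntegers_of_im_ne_zero {z : ℂ} (hz : z.im ≠ 0) : z ∉ negIntegers := by
  rintro ⟨k, -, rfl⟩
  simp at hz

/-- Away from the real axis the recurrence, solved for its leftmost term, carries a bound one unit
to the left at a time. -/
theorem exists_norm_gExt_le_of_one_le_abs_im (a b : ℝ) :
    ∃ C : ℝ, 0 < C ∧ ∀ z : ℂ, a ≤ z.re → z.re ≤ b → 1 ≤ |z.im| →
      ‖gExt z‖ ≤ C * (1 + |z.im|) := by
  have step (n : ℕ) : ∀ b : ℝ, ∃ C : ℝ, 0 < C ∧ ∀ z : ℂ, -(1 / 2) - (n : ℝ) ≤ z.re → z.re ≤ b →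
      1 ≤ |z.im| → ‖gExt z‖ ≤ C * (1 + |z.im|) := by
    induction n with
    | zero =>
      intro b
      obtain ⟨C, hC, h⟩ := exists_norm_gExt_le_of_neg_one_lt (a := -(1 / 2)) (by norm_num) b
      exact ⟨C, hC, fun z h₁ h₂ _ => h z (by simpa using h₁) h₂⟩
    | succ n ih =>
      intro b
      obtain ⟨C, hC, h⟩ := ih (b + 2)
      refine ⟨2 * C, by positivity, fun z h₁ h₂ h₃ => ?_⟩
      push_cast at h₁
      have him : z.im ≠ 0 := fun h0 => by norm_num [h0] at h₃
      have hrec := gExt_add_two (notMem_negIntegers_of_im_ne_zero him)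
      have e1 := h (z + 1) (by simp; linarith) (by simp; linarith) (by simpa using h₃)
      have e2 := h (z + 2) (by simp; linarith) (by simp; linarith) (by simpa using h₃)
      have hi1 : (z + 1).im = z.im := by simp
      have hi2 : (z + 2).im = z.im := by simp
      rw [hi1] at e1
      rw [hi2] at e2
      have hz1 : 1 ≤ ‖z + 1‖ := h₃.trans (hi1 ▸ Complex.abs_im_le_norm (z + 1))
      calc ‖gExt z‖ = ‖gExt (z + 2) + gExt (z + 1) / (z + 1)‖ := by rw [hrec, sub_add_cancel]
        _ ≤ ‖gExt (z + 2)‖ + ‖gExt (z + 1)‖ / ‖z + 1‖ := by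
          rw [← norm_div]; exact norm_add_le _ _
        _ ≤ ‖gExt (z + 2)‖ + ‖gExt (z + 1)‖ := by
          gcongr
          exact div_le_self (norm_nonneg _) hz1
        _ ≤ 2 * C * (1 + |z.im|) := by linarith
  obtain ⟨n, hn⟩ := exists_nat_gt (-(1 / 2) - a)
  obtain ⟨C, hC, h⟩ := step n b
  exact ⟨C, hC, fun z h₁ h₂ h₃ => h z (by linarith) h₂ h₃⟩

theorem polynomialGrowthInStrips_gExt : PolynomialGrowthInStrips gExt := by
  refine ⟨fun a b hab => ?_, fun a b => ?_⟩
  · obtain ⟨C, hC, h⟩ := exists_norm_gExt_le_of_one_le_abs_im a b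
    -- The part of the strip near the real axis is compact and free of poles.
    have hcont : ContinuousOn gExt (Set.Icc a b ×ℂ Set.Icc (-1) 1) := by
      intro z hz
      refine (analyticAt_gExt fun hneg => hab z hz.1.1 hz.1.2 ?_).continuousAt.continuousWithinAt
      rw [meromorphicOrderAt_gExt hneg]
      decide
    obtain ⟨M, hM⟩ := (isCompact_Icc.reProdIm isCompact_Icc).exists_bound_of_continuousOn hcont
    refine ⟨C + |M|, by positivity, 1, fun z h₁ h₂ => ?_⟩
    rw [pow_one]
    rcases le_total 1 |z.im| with him | him
    · exact (h z h₁ h₂ him).trans (by gcongr; linarith [abs_nonneg M])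
    · calc ‖gExt z‖ ≤ M := hM z ⟨⟨h₁, h₂⟩, abs_le.1 him⟩
        _ ≤ (C + |M|) * 1 := by linarith [le_abs_self M]
        _ ≤ (C + |M|) * (1 + |z.im|) := by gcongr; linarith [abs_nonneg z.im]
  · obtain ⟨C, hC, h⟩ := exists_norm_gExt_le_of_one_le_abs_im a b
    exact ⟨C, hC, 1, by simpa using h⟩

/-! ### Asymptotics, extension and arithmetic of the connection constants -/

theorem theorem1p3 :
    -- existence and value of the connection constant
    (∀ m : ℕ, (fun n : ℕ => vSeq m n) ~[atTop] (fun n : ℕ => gConst m * Real.sqrt (n : ℝ))) ∧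
    -- meromorphic extension and its properties
    (∃ g : ℂ → ℂ,
      (∀ m : ℕ, g (m : ℂ) = ((gConst m : ℝ) : ℂ)) ∧
      (∀ z : ℂ, MeromorphicAt g z) ∧
      (∀ z ∈ negIntegers, meromorphicOrderAt g z = -1) ∧
      (∀ z : ℂ, z ∉ negIntegers → AnalyticAt ℂ g z) ∧
      AnalyticAt ℂ g 0 ∧
      (∀ z : ℂ, z ∉ negIntegers → g (z + 2) = g z - g (z + 1) / (z + 1)) ∧
      PolynomialGrowthInStrips g ∧
      (∀ z : ℂ, z ∉ negIntegers →
        g z = ((Real.sqrt 2 : ℝ) : ℂ) *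
          (Complex.Gamma (z / 2 + 1) * (Complex.Gamma ((z + 1) / 2))⁻¹
            - Complex.Gamma ((z + 1) / 2) * (Complex.Gamma (z / 2))⁻¹))) ∧
    -- arithmetic structure, with the explicit rational coefficients
    (∃ p q : ℕ → ℚ,
      (∀ m : ℕ, (-1 : ℝ) ^ m * (gConst m / gConst 0) = (p m : ℝ) - Real.pi * (q m : ℝ)) ∧
      p 0 = 1 ∧ q 0 = 0 ∧ p 1 = 1 ∧ q 1 = 1 / 2 ∧
      (∀ k : ℕ, 1 ≤ k →
        p (2 * k) = (((2 * k)‼ : ℕ) : ℚ) / (((2 * k - 1)‼ : ℕ) : ℚ) ∧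
        q (2 * k) = 1 / 2 * ((((2 * k - 1)‼ : ℕ) : ℚ) / (((2 * k - 2)‼ : ℕ) : ℚ)) ∧
        p (2 * k + 1) = (((2 * k)‼ : ℕ) : ℚ) / (((2 * k - 1)‼ : ℕ) : ℚ) ∧
        q (2 * k + 1) = 1 / 2 * ((((2 * k + 1)‼ : ℕ) : ℚ) / (((2 * k)‼ : ℕ) : ℚ)))) := by
  refine ⟨vSeq_isEquivalent, ⟨gExt, gExt_natCast, meromorphicAt_gExt,
    fun z hz => meromorphicOrderAt_gExt hz, fun z hz => analyticAt_gExt hz, ?_,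
    fun z hz => gExt_add_two hz, polynomialGrowthInStrips_gExt, fun z _ => rfl⟩,
    pCoeff, qCoeff, fun m => ?_, pCoeff_zero, qCoeff_zero, pCoeff_one, qCoeff_one, fun k hk => ?_⟩
  · simpa using analyticAt_gExt (natCast_notMem_negIntegers 0)
  · have hsq : ((-1 : ℝ) ^ m) * (-1) ^ m = 1 := by rw [← mul_pow]; norm_num
    have hs : √(2 / Real.pi) ≠ 0 := by positivity
    rw [gConst_zero, gConst, mul_div_cancel_left₀ _ hs, LConst_eq_pCoeff_sub_pi_mul_qCoeff]
    linear_combination ((pCoeff m : ℝ) - Real.pi * qCoeff m) * hsq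
  · obtain ⟨k, rfl⟩ := Nat.exists_eq_add_of_le' hk
    refine ⟨pCoeff_even_eq_doubleFactorial _, ?_, ?_, qCoeff_odd_eq_doubleFactorial _⟩
    · rw [show 2 * (k + 1) = 2 * k + 2 by ring, (qCoeff_even_odd_succ k).1,
        qCoeff_odd_eq_doubleFactorial]
      rfl
    · rw [(pCoeff_odd_even_succ _).1, pCoeff_even_eq_doubleFactorial]
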